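/- Let $K$ be an algebraically closed field of characteristic zero, let $W_1,\dots,W_k$ be subgroups of the symmetric group $S_d$, and let $\chi_m\colon W_m\to K^\times$ be a one-dimensional character of $W_m$ for $m=1,\dots,k$. Symmetric functions are taken in the countable set of variables $x_0,x_1,x_2,\dots$, with power sums $p_s=\sum_{i\ge 0}x_i^s$, and $c_s(\sigma)$ is the number of cycles of length $s$ of $\sigma\in S_d$. The generalized cyclic index of a one-dimensional character $\chi\colon W\to K^\times$ of a subgroup $W\le S_d$ is $$Z(\chi)=Z(\chi;p_1,\dots,p_d)=\frac1{|W|}\sum_{\sigma\in W}\chi(\sigma)\,p_1^{c_1(\sigma)}\cdots p_d^{c_d(\sigma)} .$$ The characteristic of a generalized character $u$ of $S_d$ (an element of the additive group generated by the $K$-valued characters of the finite-dimensional $K$-linear representations of $S_d$) is $ch(u)=\frac1{d!}\sum_{\sigma\in S_d}u(\sigma)\,p_1^{c_1(\sigma)}\cdots p_d^{c_d(\sigma)}$, and the internal product $\ast$ of homogeneous symmetric functions of degree $d$ is defined by $ch(u)\ast ch(v)=ch(uv)$ for generalized characters $u,v$ of $S_d$; its identity element is $h_d=ch(1)$. For each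 $m$ let $I_m$ be a left transversal of $W_m$ in $S_d$, and let $I=I_1\times\cdots\times I_k$. For $\zeta\in S_d$ and $i=(i_1,\dots,i_k)\in I$ write $\zeta i_m=j_m\sigma_m$ with $j_m\in I_m$, $\sigma_m\in W_m$; then $\zeta\cdot i=(j_1,\dots,j_k)$ defines an action of $S_d$ on $I$, and we put $\beta_i(\zeta)=\chi_1(\sigma_1)\cdots\chi_k(\sigma_k)$. Let $T$ be a system of distinct representatives of the $S_d$-orbits in $I$. For $\omega=(\omega_1,\dots,\omega_k)\in T$ let $$W_\omega=\omega_1W_1\omega_1^{-1}\cap\dots\cap\omega_kW_k\omega_k^{-1},$$ and let $\psi_\omega$ be the restriction of $\beta_\omega$ to $W_\omega$, which is a one-dimensional character of $W_\omega$. Let $\mathbb N_0$ be the set of non-negative integers. The subgroups of $S_d$ act on $\mathbb N_0^d$ by permuting the components. Let $J(\mathbb N_0^d,\psi_\omega)$ be the set of those $W_\omega$-orbits in $\mathbb N_0^d$ which contain the maximal number $|W_\omega:\operatorname{Ker}\psi_\omega|$ of $\operatorname{Ker}\psi_\omega$-orbits, and let $$U(\chi_1,\dots,\chi_k)=\coprod_{\omega\in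 T}J(\mathbb N_0^d,\psi_\omega)$$ be their disjoint union. The weight $w(O)$ of an orbit $O$ is the monomial $x_{j_1}\cdots x_{j_d}$, where $(j_1,\dots,j_d)$ is any element of $O$. Theorem. Every monomial is the weight of only finitely many elements of $U(\chi_1,\dots,\chi_k)$, and the symmetric function $Z(\chi_1)\ast\cdots\ast Z(\chi_k)$ is the weighted inventory of $U(\chi_1,\dots,\chi_k)$: $$Z(\chi_1;p_1,\dots,p_d)\ast\cdots\ast Z(\chi_k;p_1,\dots,p_d)=\sum_{\omega\in T}\ \sum_{O\in J(\mathbb N_0^d,\psi_\omega)}w(O).$$ -/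

import Mathlib

open scoped BigOperators

namespace Redfield

noncomputable section

/-! ### Symmetric functions in the variables `x_0, x_1, x_2, …` and the internal product -/

/-- The number `c_s(σ)` of cycles of length `s` of `σ` (fixed points are the cycles of length 1). -/
def cycleCount {d : ℕ} (s : ℕ) (σ : Equiv.Perm (Fin d)) : ℕ :=
  σ.partition.parts.count s

open Classical in
/-- The power sum `p_s = ∑_{i ∈ ℕ} x_i ^ s`, used for `s ≥ 1` only. -/
def powerSum (K : Type*) [Field K] (s : ℕ) : MvPowerSeries ℕ K :=
  fun n => if ∃ i : ℕ, n = Finsupp.single i s then 1 else 0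

/-- `p_1 ^ c_1(σ) ⋯ p_d ^ c_d(σ)`. -/
def cycleMonomial (K : Type*) [Field K] {d : ℕ} (σ : Equiv.Perm (Fin d)) : MvPowerSeries ℕ K :=
  ∏ s ∈ Finset.Icc 1 d, powerSum K s ^ cycleCount s σ

/-- The group `R^d` of generalized characters of `S_d`: the additive group generated by the
characters of the finite-dimensional `K`-linear representations of `S_d`. -/
def genChar (K : Type*) [Field K] (d : ℕ) : AddSubgroup (Equiv.Perm (Fin d) → K) :=
  AddSubgroup.closure {u | ∃ (n : ℕ) (ρ : Representation K (Equiv.Perm (Fin d)) (Fin n → K)),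
    u = ρ.character}

/-- The characteristic map, `ch(u) = (1 / d!) ∑_{σ ∈ S_d} u(σ) p_1 ^ c_1(σ) ⋯ p_d ^ c_d(σ)`. -/
def ch {K : Type*} [Field K] {d : ℕ} (u : Equiv.Perm (Fin d) → K) : MvPowerSeries ℕ K :=
  (d.factorial : K)⁻¹ • ∑ σ : Equiv.Perm (Fin d), u σ • cycleMonomial K σ

/-- The internal product of symmetric functions of degree `d`: `ch u ∗ ch v = ch (u v)` for
generalized characters `u`, `v` of `S_d`. (On arguments that are not of the form `ch u` with `u` a
generalized character the value is immaterial.) -/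
def internalMul {K : Type*} [Field K] (d : ℕ) (f g : MvPowerSeries ℕ K) : MvPowerSeries ℕ K :=
  ch (Function.invFunOn (ch (d := d)) (genChar K d : Set (Equiv.Perm (Fin d) → K)) f *
    Function.invFunOn (ch (d := d)) (genChar K d : Set (Equiv.Perm (Fin d) → K)) g)

/-- `f_1 ∗ ⋯ ∗ f_k`; the identity element of the internal product is `h_d = ch 1`. -/
def internalProd {K : Type*} [Field K] (d : ℕ) {k : ℕ} (f : Fin k → MvPowerSeries ℕ K) :
    MvPowerSeries ℕ K :=
  (List.ofFn f).foldr (internalMul d) (ch (1 : Equiv.Perm (Fin d) → K))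

open Classical in
/-- The generalized cyclic index
`Z(χ; p_1, …, p_d) = |W|⁻¹ ∑_{σ ∈ W} χ(σ) p_1 ^ c_1(σ) ⋯ p_d ^ c_d(σ)`. -/
def cycleIndex {K : Type*} [Field K] {d : ℕ} {W : Subgroup (Equiv.Perm (Fin d))} (χ : W →* Kˣ) :
    MvPowerSeries ℕ K :=
  (Nat.card W : K)⁻¹ • ∑ σ : W, (χ σ : K) • cycleMonomial K (σ : Equiv.Perm (Fin d))

/-! ### The action of `S_d` on products of transversals and the characters `ψ_ω` -/

section Transversals

variable {d k : ℕ} {W : Fin k → Subgroup (Equiv.Perm (Fin d))}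
  {I : Fin k → Set (Equiv.Perm (Fin d))}

/-- The action of `ζ ∈ S_d` on `I_1 × ⋯ × I_k`: if `ζ i_m = j_m σ_m` with `j_m ∈ I_m` and
`σ_m ∈ W_m`, then `i = (i_1, …, i_k)` is sent to `(j_1, …, j_k)`. -/
def act (hI : ∀ m, Subgroup.IsComplement (I m) (W m : Set (Equiv.Perm (Fin d))))
    (ζ : Equiv.Perm (Fin d)) (i : ∀ m, I m) : ∀ m, I m :=
  fun m => ((hI m).equiv (ζ * (i m : Equiv.Perm (Fin d)))).1

/-- `β_i(ζ) = χ_1(σ_1) ⋯ χ_k(σ_k)`, where `ζ i_m = j_m σ_m` with `j_m ∈ I_m`, `σ_m ∈ W_m`. -/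
def beta {K : Type*} [Field K]
    (hI : ∀ m, Subgroup.IsComplement (I m) (W m : Set (Equiv.Perm (Fin d))))
    (χ : ∀ m, W m →* Kˣ) (i : ∀ m, I m) (ζ : Equiv.Perm (Fin d)) : Kˣ :=
  ∏ m, χ m ((hI m).equiv (ζ * (i m : Equiv.Perm (Fin d)))).2

/-- `T` is a system of distinct representatives of the `S_d`-orbits in `I_1 × ⋯ × I_k`. -/
def IsRepSystem (hI : ∀ m, Subgroup.IsComplement (I m) (W m : Set (Equiv.Perm (Fin d))))
    (T : Set (∀ m, I m)) : Prop :=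
  ∀ i : ∀ m, I m, ∃! ω : ∀ m, I m, ω ∈ T ∧ ∃ ζ : Equiv.Perm (Fin d), act hI ζ ω = i

/-- The intersection `ω_1 W_1 ω_1⁻¹ ∩ ⋯ ∩ ω_k W_k ω_k⁻¹`. -/
def stab (W : Fin k → Subgroup (Equiv.Perm (Fin d))) (ω : ∀ m, I m) :
    Subgroup (Equiv.Perm (Fin d)) :=
  ⨅ m, (W m).map (MulAut.conj (ω m : Equiv.Perm (Fin d))).toMonoidHom

theorem conj_mem_of_mem_stab {ω : ∀ m, I m} {ζ : Equiv.Perm (Fin d)} (hζ : ζ ∈ stab W ω)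
    (m : Fin k) :
    (ω m : Equiv.Perm (Fin d))⁻¹ * ζ * (ω m : Equiv.Perm (Fin d)) ∈ W m := by
  obtain ⟨w, hw, rfl⟩ := Subgroup.mem_map.1 (Subgroup.mem_iInf.1 hζ m)
  simpa [mul_assoc] using hw

theorem equiv_of_mem_stab
    (hI : ∀ m, Subgroup.IsComplement (I m) (W m : Set (Equiv.Perm (Fin d))))
    {ω : ∀ m, I m} {ζ : Equiv.Perm (Fin d)} (hζ : ζ ∈ stab W ω) (m : Fin k) :
    (hI m).equiv (ζ * (ω m : Equiv.Perm (Fin d))) =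
      (ω m, ⟨_, conj_mem_of_mem_stab hζ m⟩) := by
  rw [← Equiv.eq_symm_apply, Subgroup.IsComplement.equiv_symm_apply]
  simp [mul_assoc]

/-- The one-dimensional character `ψ_ω` of `ω_1 W_1 ω_1⁻¹ ∩ ⋯ ∩ ω_k W_k ω_k⁻¹`, the restriction
of `β_ω`. -/
def psi {K : Type*} [Field K]
    (hI : ∀ m, Subgroup.IsComplement (I m) (W m : Set (Equiv.Perm (Fin d))))
    (χ : ∀ m, W m →* Kˣ) (ω : ∀ m, I m) : stab W ω →* Kˣ :=
  MonoidHom.mk' (fun ζ => beta hI χ ω (ζ : Equiv.Perm (Fin d))) <| by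
    intro a b
    unfold beta
    rw [← Finset.prod_mul_distrib]
    refine Finset.prod_congr rfl fun m _ => ?_
    rw [equiv_of_mem_stab hI a.2 m, equiv_of_mem_stab hI b.2 m, equiv_of_mem_stab hI (a * b).2 m,
      ← map_mul]
    congr 1
    ext1
    simp [mul_assoc]

end Transversals

/-! ### Orbits on `ℕ^d`, weights and inventories -/

/-- The orbit of `x ∈ ℕ^d` under a group `H ≤ S_d` that permutes the components. -/
def wordOrbit {d : ℕ} (H : Subgroup (Equiv.Perm (Fin d))) (x : Fin d → ℕ) : Set (Fin d → ℕ) :=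
  Set.range fun σ : H => fun a : Fin d => x ((σ : Equiv.Perm (Fin d))⁻¹ a)

/-- The set `J(ℕ^d, ψ)` of the `H`-orbits in `ℕ^d` that contain exactly `|H : Ker ψ|` orbits of
`Ker ψ`, the maximal possible number. -/
def maxOrbits {K : Type*} [Field K] {d : ℕ} {H : Subgroup (Equiv.Perm (Fin d))} (ψ : H →* Kˣ) :
    Set (Set (Fin d → ℕ)) :=
  {O | (∃ x, O = wordOrbit H x) ∧
    {P | P ⊆ O ∧ ∃ y, P = wordOrbit (ψ.ker.map H.subtype) y}.ncard = ψ.ker.index}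

/-- `U(χ_1, …, χ_k)`, the disjoint union of the sets `J(ℕ^d, ψ_ω)` over `ω ∈ T`. -/
def U {K : Type*} [Field K] {d k : ℕ} {W : Fin k → Subgroup (Equiv.Perm (Fin d))}
    {I : Fin k → Set (Equiv.Perm (Fin d))}
    (hI : ∀ m, Subgroup.IsComplement (I m) (W m : Set (Equiv.Perm (Fin d))))
    (χ : ∀ m, W m →* Kˣ) (T : Set (∀ m, I m)) : Type :=
  Σ ω : T, maxOrbits (psi hI χ (ω : ∀ m, I m))

/-- The exponent of the monomial `x_{j_1} ⋯ x_{j_d}` of `j = (j_1, …, j_d) ∈ ℕ^d`. -/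
def content {d : ℕ} (j : Fin d → ℕ) : ℕ →₀ ℕ :=
  ∑ a, Finsupp.single (j a) 1

open Classical in
/-- The exponent of the weight `x_{j_1} ⋯ x_{j_d}` of an orbit, where `j` is any of its elements
(all of them have the same content). -/
def orbitWeight {d : ℕ} (O : Set (Fin d → ℕ)) : ℕ →₀ ℕ :=
  if h : O.Nonempty then content h.some else 0

/-- The exponent of the weight of an element of `U(χ_1, …, χ_k)`. -/
def U.weight {K : Type*} [Field K] {d k : ℕ} {W : Fin k → Subgroup (Equiv.Perm (Fin d))}
    {I : Fin k → Set (Equiv.Perm (Fin d))}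
    {hI : ∀ m, Subgroup.IsComplement (I m) (W m : Set (Equiv.Perm (Fin d)))}
    {χ : ∀ m, W m →* Kˣ} {T : Set (∀ m, I m)} (u : U hI χ T) : ℕ →₀ ℕ :=
  orbitWeight (u.2 : Set (Fin d → ℕ))

/-- The weighted inventory `∑_{u ∈ A} x ^ w(u)` of a set `A` whose elements have monomial weights,
where every monomial is the weight of finitely many elements of `A`. -/
def inventory (K : Type*) [Field K] {A : Type*} (w : A → ℕ →₀ ℕ) : MvPowerSeries ℕ K :=
  fun n => (Nat.card {u : A // w u = n} : K)

end

end Redfield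

/-!
Let `G` act monomially, `g • e_x = β_x(g) e_{g • x}`. The average over `G` of a class function
against the character of this action is the sum, over representatives `x` of the orbits, of its
averages against `β_x` over the stabilizers of `x`. For `S_d` acting on a transversal of `W` this
says that `Z(χ)` is the characteristic of the character induced from `χ`; for a product of
transversals, whose monomial character is the product of the induced ones, it gives
`Z(χ_1) ∗ ⋯ ∗ Z(χ_k) = ∑_ω Z(ψ_ω)`. The internal product is meaningful since `ch` is injective on
class functions: a coefficient of `ch u` is the average of `u` over a Young subgroup. Finally, for
`W_ω` acting on the words of a given content it is a weighted Burnside lemma: the average of `ψ_ω`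
over the stabilizer of a word is `1` or `0`, and it is `1` exactly when the orbit of the word splits
into the maximal number of orbits of `Ker ψ_ω`.
-/

namespace Redfield

noncomputable section

open MulAction

section Average

variable {G X T M : Type*} [Group G] [MulAction G X]

/-- `r` is a system of distinct representatives of the `G`-orbits in `X`, indexed by `T`. -/
def IsOrbitReps (G : Type*) {X T : Type*} [Group G] [MulAction G X] (r : T → X) : Prop :=
  ∀ x, ∃! t, x ∈ orbit G (r t)

theorem isOrbitReps_const [IsPretransitive G X] (x : X) :
    IsOrbitReps G fun _ : Unit => x :=
  fun y => ⟨(), exists_smul_eq G x y, fun _ _ => rfl⟩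

/-- The average of `f` over a finite group (or type) `G`, with coefficients in the field `K`. -/
def average (K : Type*) [Field K] {G : Type*} [AddCommGroup M] [Module K M] (f : G → M) : M :=
  (Nat.card G : K)⁻¹ • ∑ᶠ g, f g

section

variable {K N : Type*} [Field K] {G : Type*} [AddCommGroup M] [Module K M]
  [AddCommGroup N] [Module K N]

theorem average_eq [Fintype G] (f : G → M) : average K f = (Nat.card G : K)⁻¹ • ∑ g, f g := by
  rw [average, finsum_eq_sum_of_fintype]

theorem map_average [Finite G] (φ : M →ₗ[K] N) (f : G → M) :
    φ (average K f) = average K fun g => φ (f g) := by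
  cases nonempty_fintype G
  rw [average_eq, map_smul, map_sum, average_eq]

end

theorem IsOrbitReps.sum_eq [Fintype X] [Fintype T] [AddCommMonoid M] {r : T → X}
    (hr : IsOrbitReps G r) {F : X → M} (hF : ∀ (g : G) x, F (g • x) = F x) :
    ∑ x, F x = ∑ t, Nat.card (orbit G (r t)) • F (r t) := by
  classical
  have hbij : Function.Bijective fun p : Σ t, orbit G (r t) => (p.2 : X) := by
    constructor
    · rintro ⟨s, x, hs⟩ ⟨t, y, ht⟩ (rfl : x = y)
      obtain rfl := (hr x).unique hs ht
      rfl
    · intro x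
      obtain ⟨t, ht, -⟩ := hr x
      exact ⟨⟨t, x, ht⟩, rfl⟩
  have horbit : ∀ t (x : orbit G (r t)), F x = F (r t) := by
    rintro t ⟨-, g, rfl⟩
    exact hF g (r t)
  rw [← Fintype.sum_bijective _ hbij _ _ fun _ => rfl, Fintype.sum_sigma]
  refine Finset.sum_congr rfl fun t _ => ?_
  rw [Finset.sum_congr rfl fun x _ => horbit t x, Finset.sum_const, Finset.card_univ,
    Nat.card_eq_fintype_card]

theorem IsOrbitReps.inv_card_smul_sum {K : Type*} [Field K] [CharZero K] [Finite G] [Fintype X]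
    [Fintype T] [AddCommGroup M] [Module K M] {r : T → X} (hr : IsOrbitReps G r) {F : X → M}
    (hF : ∀ (g : G) x, F (g • x) = F x) :
    (Nat.card G : K)⁻¹ • ∑ x, F x = ∑ t, (Nat.card (stabilizer G (r t)) : K)⁻¹ • F (r t) := by
  have hcard (x : X) : (Nat.card G : K)⁻¹ * Nat.card (orbit G x) =
      (Nat.card (stabilizer G x) : K)⁻¹ := by
    have hmul : (Nat.card (orbit G x) : K) * Nat.card (stabilizer G x) = Nat.card G := by
      rw [← Nat.cast_mul, Nat.card_congr (orbitEquivQuotientStabilizer G x),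
        ← Subgroup.card_eq_card_quotient_mul_card_subgroup]
    have hne : (Nat.card G : K) ≠ 0 := Nat.cast_ne_zero.2 Nat.card_pos.ne'
    rw [← hmul] at hne ⊢
    rw [mul_inv_rev, inv_mul_cancel_right₀ (left_ne_zero_of_mul hne)]
  simp_rw [hr.sum_eq hF, Finset.smul_sum, ← Nat.cast_smul_eq_nsmul K, smul_smul, hcard]

end Average

section Monomial

variable {G X R : Type*} [Group G] [MulAction G X]

/-- A function that is constant on the conjugacy classes of `G`. -/
def IsClassFun {M : Type*} (u : G → M) : Prop :=
  ∀ g h, u (h * g * h⁻¹) = u g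

/-- The coefficients `β_x(g)` of a monomial action `g • e_x = β_x(g) e_{g • x}` of `G` on the free
module with basis `X`. -/
def IsMultiplier [CommRing R] (β : X → G → Rˣ) : Prop :=
  ∀ x g h, β x (g * h) = β (h • x) g * β x h

open Classical in
/-- The trace of the monomial action with coefficients `β`. -/
def monomialChar [CommRing R] [Fintype X] (β : X → G → Rˣ) (g : G) : R :=
  ∑ x with g • x = x, (β x g : R)

variable [CommRing R] {β : X → G → Rˣ}

/-- The restriction of `β_x` to the stabilizer of `x`, a one-dimensional character. -/
def IsMultiplier.stabilizerHom (hβ : IsMultiplier β) (x : X) : stabilizer G x →* Rˣ :=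
  MonoidHom.mk' (fun g => β x g) fun g h => by
    rw [Subgroup.coe_mul, hβ, mem_stabilizer_iff.1 h.2]

theorem IsMultiplier.one_right (hβ : IsMultiplier β) (x : X) : β x 1 = 1 := by
  simpa using hβ x 1 1

theorem isMultiplier_one : IsMultiplier (1 : X → G → Rˣ) :=
  fun _ _ _ => (mul_one 1).symm

theorem IsMultiplier.conj (hβ : IsMultiplier β) {x : X} {h : G} (hx : h • x = x) (g : G) :
    β (g • x) (g * h * g⁻¹) = β x h := by
  have hgh : β (g • x) (g * h * g⁻¹) * β x g = β x g * β x h := by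
    rw [← hβ, inv_mul_cancel_right, hβ, hx]
  rwa [mul_comm, mul_left_cancel_iff] at hgh

theorem average_monomialChar_smul {K T M : Type*} [Field K] [CharZero K] [Finite G] [Fintype X]
    [Fintype T] [AddCommGroup M] [Module K M] {β : X → G → Kˣ} (hβ : IsMultiplier β)
    {f : G → M} (hf : IsClassFun f) {r : T → X} (hr : IsOrbitReps G r) :
    average K (fun g => monomialChar β g • f g) =
      ∑ t, average K fun g : stabilizer G (r t) => (β (r t) g : K) • f g := by
  classical
  cases nonempty_fintype G
  have hconj (g : G) (x : X) : ∑ h : stabilizer G (g • x), (β (g • x) h : K) • f h =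
      ∑ h : stabilizer G x, (β x h : K) • f h := by
    refine (Fintype.sum_equiv (stabilizerEquivStabilizer (rfl : g • x = g • x)).toEquiv _ _
      fun h => ?_).symm
    simp [stabilizerEquivStabilizer_apply, hβ.conj h.2, hf (h : G) g]
  have hsum : ∑ g, monomialChar β g • f g =
      ∑ x, ∑ g : stabilizer G x, (β x g : K) • f g := by
    simp_rw [monomialChar, Finset.sum_smul, Finset.sum_filter]
    rw [Finset.sum_comm]
    refine Finset.sum_congr rfl fun x _ => ?_
    rw [← Finset.sum_filter]
    exact Finset.sum_subtype _ (by simp) _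
  simp_rw [average_eq]
  rw [hsum, hr.inv_card_smul_sum hconj]

theorem average_card_fixedBy_smul {K T M : Type*} [Field K] [CharZero K] [Finite G] [Finite X]
    [Fintype T] [AddCommGroup M] [Module K M] {f : G → M} (hf : IsClassFun f) {r : T → X}
    (hr : IsOrbitReps G r) :
    average K (fun g => (Nat.card (fixedBy X g) : K) • f g) =
      ∑ t, average K fun g : stabilizer G (r t) => f g := by
  classical
  cases nonempty_fintype X
  have hcard (g : G) : monomialChar (1 : X → G → Kˣ) g = Nat.card (fixedBy X g) := by
    simp [monomialChar, fixedBy, Fintype.card_subtype]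
  simpa [hcard] using average_monomialChar_smul (isMultiplier_one (R := K)) hf hr

open Classical in
/-- The matrices of the monomial action with coefficients `β`. -/
def IsMultiplier.matrixHom [Fintype X] (hβ : IsMultiplier β) : G →* Matrix X X R where
  toFun g := Matrix.of fun y x => if g • x = y then (β x g : R) else 0
  map_one' := by
    ext y x
    simp [Matrix.one_apply, hβ.one_right, eq_comm]
  map_mul' g h := by
    ext y x
    simp [Matrix.mul_apply, hβ x g h, mul_smul]

theorem IsMultiplier.trace_matrixHom [Fintype X] (hβ : IsMultiplier β) (g : G) :
    (hβ.matrixHom g).trace = monomialChar β g := by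
  simp [Matrix.trace, matrixHom, monomialChar, Finset.sum_filter]

section Pi

variable {ι : Type*} [Fintype ι] {X : ι → Type*} [∀ m, MulAction G (X m)]
  {β : ∀ m, X m → G → Rˣ}

theorem isMultiplier_pi (hβ : ∀ m, IsMultiplier (β m)) :
    IsMultiplier fun (x : ∀ m, X m) g => ∏ m, β m (x m) g := by
  intro x g h
  simp_rw [← Finset.prod_mul_distrib, hβ _ _ g h, Pi.smul_apply]

theorem monomialChar_pi [DecidableEq ι] [∀ m, Fintype (X m)] (β : ∀ m, X m → G → Rˣ) (g : G) :
    monomialChar (fun (x : ∀ m, X m) g => ∏ m, β m (x m) g) g = ∏ m, monomialChar (β m) g := by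
  simp_rw [monomialChar, Finset.prod_univ_sum, Units.coe_prod]
  refine Finset.sum_congr ?_ fun _ _ => rfl
  ext x
  simp [funext_iff]

end Pi

end Monomial

section Inventory

variable (K : Type*) [Field K]

theorem inventory_comp_equiv {A B : Type*} (e : A ≃ B) (w : B → ℕ →₀ ℕ) :
    inventory K (w ∘ e) = inventory K w :=
  funext fun _ => congrArg Nat.cast <| Nat.card_congr <| e.subtypeEquiv fun _ => Iff.rfl

theorem powerSum_eq_inventory {s : ℕ} (hs : s ≠ 0) :
    powerSum K s = inventory K fun i : ℕ => Finsupp.single i s := by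
  funext n
  have : Subsingleton {i : ℕ // Finsupp.single i s = n} :=
    ⟨fun i j => Subtype.ext <| Finsupp.single_left_injective hs (i.2.trans j.2.symm)⟩
  rw [powerSum, inventory]
  split_ifs with h
  · obtain ⟨i, rfl⟩ := h
    have : Nonempty {j : ℕ // Finsupp.single j s = Finsupp.single i s} := ⟨⟨i, rfl⟩⟩
    rw [Nat.card_unique, Nat.cast_one]
  · have : IsEmpty {i : ℕ // Finsupp.single i s = n} := ⟨fun i => h ⟨i, i.2.symm⟩⟩
    rw [Nat.card_of_isEmpty, Nat.cast_zero]

variable {ι : Type*} {A : ι → Type*} {w : ∀ i, A i → ℕ →₀ ℕ}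

theorem finite_sigma_weight_eq [Finite ι] {n : ℕ →₀ ℕ} (hw : ∀ i, {a | w i a = n}.Finite) :
    {u : Σ i, A i | w u.1 u.2 = n}.Finite := by
  refine (Set.finite_iUnion fun i => (hw i).image (Sigma.mk i)).subset ?_
  rintro ⟨i, a⟩ ha
  exact Set.mem_iUnion.2 ⟨i, a, ha, rfl⟩

theorem inventory_sigma [Fintype ι] (hw : ∀ i n, {a | w i a = n}.Finite) :
    inventory K (fun u : Σ i, A i => w u.1 u.2) = ∑ i, inventory K (w i) := by
  ext n
  have hfin (i) : Finite {a // w i a = n} := (hw i n).to_subtype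
  have e : {u : Σ i, A i // w u.1 u.2 = n} ≃ Σ i, {a // w i a = n} :=
    ⟨fun u => ⟨u.1.1, u.1.2, u.2⟩, fun u => ⟨⟨u.1, u.2.1⟩, u.2.2⟩, fun _ => rfl, fun _ => rfl⟩
  rw [map_sum]
  simp only [MvPowerSeries.coeff_apply, inventory]
  rw [Nat.card_congr e, Nat.card_sigma, Nat.cast_sum]

theorem prod_inventory [Fintype ι] (hw : ∀ i n, {a | w i a = n}.Finite) :
    ∏ i, inventory K (w i) = inventory K fun y : ∀ i, A i => ∑ i, w i (y i) := by
  classical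
  ext n
  have hfin (i n) : Finite {a // w i a = n} := (hw i n).to_subtype
  let weights (y : {y : ∀ i, A i // ∑ i, w i (y i) = n}) : Finset.univ.finsuppAntidiag n :=
    ⟨Finsupp.equivFunOnFinite.symm fun i => w i (y.1 i), by
      simpa [Finset.mem_finsuppAntidiag] using y.2⟩
  let fiberEquiv (l : Finset.univ.finsuppAntidiag n) :
      {y // weights y = l} ≃ ∀ i, {a // w i a = l.1 i} :=
    { toFun := fun y i => ⟨y.1.1 i, DFunLike.congr_fun (congrArg Subtype.val y.2) i⟩
      invFun := fun z => ⟨⟨fun i => z i, by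
          simpa only [(z _).2] using (Finset.mem_finsuppAntidiag.1 l.2).1⟩,
        Subtype.ext <| Finsupp.ext fun i => (z i).2⟩
      left_inv := fun _ => rfl
      right_inv := fun _ => rfl }
  rw [MvPowerSeries.coeff_prod]
  simp only [MvPowerSeries.coeff_apply, inventory]
  rw [Nat.card_congr ((Equiv.sigmaFiberEquiv weights).symm.trans
    (Equiv.sigmaCongrRight fiberEquiv)), Nat.card_sigma, Nat.cast_sum, Finset.sum_coe_sort
    (Finset.univ.finsuppAntidiag n) fun l => (Nat.card (∀ i, {a // w i a = l i}) : K)]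
  simp only [Nat.card_pi, Nat.cast_prod]

end Inventory

section CycleMonomial

variable {α β : Type*} {σ : Equiv.Perm α}

theorem comp_perm_eq_iff_le_ker [Finite α] {x : α → β} :
    x ∘ σ = x ↔ Equiv.Perm.SameCycle.setoid σ ≤ Setoid.ker x := by
  refine ⟨fun hx a b hab => ?_, fun h => funext fun a => h (Equiv.Perm.sameCycle_apply_left.2 .rfl)⟩
  obtain ⟨i, rfl⟩ := hab.exists_nat_pow_eq
  rw [Setoid.ker_def, Equiv.Perm.coe_pow]
  exact (congrFun (Function.iterate_invariant hx i) a).symm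

open Classical in
/-- The elements of the class `q`, used for the orbits of a permutation `σ`, which are the classes
of `Equiv.Perm.SameCycle.setoid σ`. -/
def classFinset [Fintype α] {s : Setoid α} (q : Quotient s) : Finset α :=
  {a | Quotient.mk s a = q}

theorem mem_classFinset [Fintype α] {s : Setoid α} {q : Quotient s} {a : α} :
    a ∈ classFinset q ↔ Quotient.mk s a = q := by
  simp [classFinset]

theorem classFinset_injective [Fintype α] {s : Setoid α} :
    Function.Injective (classFinset (s := s)) := by
  intro p q h
  obtain ⟨a, rfl⟩ := p.exists_rep
  rw [← mem_classFinset, ← h, mem_classFinset]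

theorem card_classFinset_ne_zero [Fintype α] {s : Setoid α} (q : Quotient s) :
    (classFinset q).card ≠ 0 := by
  obtain ⟨a, rfl⟩ := q.exists_rep
  exact Finset.card_ne_zero_of_mem (mem_classFinset.2 rfl)

theorem classFinset_mk_of_mem_support [Fintype α] [DecidableEq α] {a : α}
    (ha : a ∈ σ.support) :
    classFinset (Quotient.mk (Equiv.Perm.SameCycle.setoid σ) a) = (σ.cycleOf a).support := by
  ext b
  rw [mem_classFinset, Equiv.Perm.mem_support_cycleOf_iff' (Equiv.Perm.mem_support.1 ha),
    Quotient.eq]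
  exact Equiv.Perm.sameCycle_comm

theorem classFinset_mk_of_notMem_support [Fintype α] [DecidableEq α] {a : α}
    (ha : a ∉ σ.support) :
    classFinset (Quotient.mk (Equiv.Perm.SameCycle.setoid σ) a) = {a} := by
  ext b
  rw [mem_classFinset, Quotient.eq, Finset.mem_singleton]
  refine ⟨fun h => Equiv.Perm.SameCycle.eq_of_right h (Equiv.Perm.notMem_support.1 ha), ?_⟩
  rintro rfl
  exact .rfl

open Classical in
theorem image_classFinset [Fintype α] [DecidableEq α] (σ : Equiv.Perm α) :
    Finset.univ.image (classFinset (s := Equiv.Perm.SameCycle.setoid σ)) =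
      σ.cycleFactorsFinset.image Equiv.Perm.support ∪ σ.supportᶜ.image singleton := by
  ext t
  simp only [Finset.mem_image, Finset.mem_univ, true_and, Finset.mem_union, Finset.mem_compl]
  constructor
  · rintro ⟨q, rfl⟩
    obtain ⟨a, rfl⟩ := q.exists_rep
    by_cases ha : a ∈ σ.support
    · exact Or.inl ⟨σ.cycleOf a, Equiv.Perm.cycleOf_mem_cycleFactorsFinset_iff.2 ha,
        (classFinset_mk_of_mem_support ha).symm⟩
    · exact Or.inr ⟨a, ha, (classFinset_mk_of_notMem_support ha).symm⟩
  · rintro (⟨c, hc, rfl⟩ | ⟨a, ha, rfl⟩)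
    · obtain ⟨a, ha⟩ := (Equiv.Perm.mem_cycleFactorsFinset_iff.1 hc).1.nonempty_support
      refine ⟨Quotient.mk _ a, ?_⟩
      rw [classFinset_mk_of_mem_support (Equiv.Perm.mem_cycleFactorsFinset_support_le hc ha),
        Equiv.Perm.cycle_is_cycleOf ha hc]
    · exact ⟨Quotient.mk _ a, classFinset_mk_of_notMem_support ha⟩

theorem disjoint_image_support_image_singleton [Fintype α] [DecidableEq α] (σ : Equiv.Perm α)
    (s : Finset α) :
    Disjoint (σ.cycleFactorsFinset.image Equiv.Perm.support) (s.image singleton) := by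
  rw [Finset.disjoint_left]
  rintro t ht ht'
  obtain ⟨c, hc, rfl⟩ := Finset.mem_image.1 ht
  obtain ⟨a, -, ha⟩ := Finset.mem_image.1 ht'
  have htwo := (Equiv.Perm.mem_cycleFactorsFinset_iff.1 hc).1.two_le_card_support
  simp [← ha] at htwo

theorem injOn_support_cycleFactorsFinset [Fintype α] [DecidableEq α] (σ : Equiv.Perm α) :
    Set.InjOn Equiv.Perm.support (σ.cycleFactorsFinset : Set (Equiv.Perm α)) := by
  intro c hc c' hc' h
  obtain ⟨a, ha⟩ := (Equiv.Perm.mem_cycleFactorsFinset_iff.1 hc).1.nonempty_support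
  rw [Equiv.Perm.cycle_is_cycleOf ha hc, Equiv.Perm.cycle_is_cycleOf (h ▸ ha) hc']

open Classical in
theorem parts_partition_eq_map_card_classFinset [Fintype α] [DecidableEq α] (σ : Equiv.Perm α) :
    σ.partition.parts =
      (Finset.univ : Finset (Quotient (Equiv.Perm.SameCycle.setoid σ))).val.map
        fun q => (classFinset q).card := by
  have hmap : (Finset.univ : Finset (Quotient (Equiv.Perm.SameCycle.setoid σ))).val.map
      (fun q => (classFinset q).card) =
      (Finset.univ.image (classFinset (s := Equiv.Perm.SameCycle.setoid σ))).val.map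
        Finset.card := by
    rw [Finset.image_val_of_injOn classFinset_injective.injOn, Multiset.map_map]
    rfl
  rw [hmap, image_classFinset,
    ← Finset.disjUnion_eq_union _ _ (disjoint_image_support_image_singleton σ _),
    Finset.disjUnion_val, Multiset.map_add,
    Finset.image_val_of_injOn (injOn_support_cycleFactorsFinset σ),
    Finset.image_val_of_injOn Finset.singleton_injective.injOn,
    Multiset.map_map, Multiset.map_map, Equiv.Perm.parts_partition, Equiv.Perm.cycleType_def]
  congr 1
  simp [Finset.card_compl]

variable (K : Type*) [Field K] {d : ℕ}

theorem cycleMonomial_eq_prod_map (σ : Equiv.Perm (Fin d)) :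
    cycleMonomial K σ = (σ.partition.parts.map (powerSum K)).prod := by
  rw [Finset.prod_multiset_map_count]
  refine (Finset.prod_subset (fun s hs => ?_) fun s _ hs => ?_).symm
  · rw [Multiset.mem_toFinset] at hs
    have hle := Multiset.le_sum_of_mem hs
    rw [σ.partition.parts_sum, Fintype.card_fin] at hle
    exact Finset.mem_Icc.2 ⟨σ.partition.parts_pos hs, hle⟩
  · rw [Multiset.mem_toFinset, ← Multiset.count_eq_zero] at hs
    rw [cycleCount, hs, pow_zero]

open Classical in
theorem content_comp_mk {s : Setoid (Fin d)} (y : Quotient s → ℕ) :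
    content (y ∘ Quotient.mk s) = ∑ q, Finsupp.single (y q) (classFinset q).card := by
  rw [content, ← Finset.sum_fiberwise Finset.univ (Quotient.mk s)]
  refine Finset.sum_congr rfl fun q _ => ?_
  rw [Finset.sum_congr rfl (g := fun _ => Finsupp.single (y q) 1)
    fun a ha => by rw [Function.comp_apply, (Finset.mem_filter.1 ha).2]]
  rw [Finset.sum_const, Finsupp.smul_single, smul_eq_mul, mul_one, classFinset]

/-- A word fixed by `σ` is a choice of one letter for each cycle of `σ`. -/
def fixedWordsEquiv [Finite α] (σ : Equiv.Perm α) :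
    {x : α → β // x ∘ σ = x} ≃ (Quotient (Equiv.Perm.SameCycle.setoid σ) → β) :=
  (Equiv.subtypeEquivRight fun _ => comp_perm_eq_iff_le_ker).trans (Setoid.liftEquiv _)

theorem cycleMonomial_eq_inventory (σ : Equiv.Perm (Fin d)) :
    cycleMonomial K σ = inventory K fun x : {x : Fin d → ℕ // x ∘ σ = x} => content x.1 := by
  classical
  have hfin (s) (hs : s ≠ 0) (n : ℕ →₀ ℕ) : {i : ℕ | Finsupp.single i s = n}.Finite :=
    (Set.finite_singleton n).preimage (Finsupp.single_left_injective hs).injOn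
  calc cycleMonomial K σ
      = ∏ q : Quotient (Equiv.Perm.SameCycle.setoid σ), powerSum K (classFinset q).card := by
        rw [cycleMonomial_eq_prod_map, parts_partition_eq_map_card_classFinset, Multiset.map_map]
        rfl
    _ = ∏ q : Quotient (Equiv.Perm.SameCycle.setoid σ),
          inventory K fun i : ℕ => Finsupp.single i (classFinset q).card :=
        Finset.prod_congr rfl fun q _ => powerSum_eq_inventory K (card_classFinset_ne_zero q)
    _ = inventory K fun y : Quotient (Equiv.Perm.SameCycle.setoid σ) → ℕ =>
          content (y ∘ Quotient.mk _) := by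
        simp_rw [content_comp_mk]
        exact prod_inventory K fun q => hfin _ (card_classFinset_ne_zero q)
    _ = _ := (inventory_comp_equiv K (fixedWordsEquiv σ) _).symm

theorem isClassFun_cycleMonomial : IsClassFun (cycleMonomial K (d := d)) := by
  intro σ τ
  have h : (τ * σ * τ⁻¹).partition = σ.partition :=
    Equiv.Perm.partition_eq_of_isConj.1 (isConj_iff.2 ⟨τ, rfl⟩).symm
  simp only [cycleMonomial, cycleCount, h]

end CycleMonomial

local instance {d : ℕ} : MulAction (Equiv.Perm (Fin d)) (Fin d → ℕ) :=
  arrowAction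

section Words

variable {d : ℕ}

theorem content_apply (x : Fin d → ℕ) (c : ℕ) : content x c = Fintype.card {a // x a = c} := by
  rw [content, Finsupp.finsetSum_apply, Fintype.card_subtype, Finset.card_filter]
  simp only [Finsupp.single_apply]

theorem finite_content_eq (n : ℕ →₀ ℕ) : {x : Fin d → ℕ | content x = n}.Finite := by
  refine (Set.Finite.pi' fun _ : Fin d => n.support.finite_toSet).subset ?_
  rintro x rfl a
  have : Nonempty {b // x b = x a} := ⟨⟨a, rfl⟩⟩
  rw [Finset.mem_coe, Finsupp.mem_support_iff, content_apply]
  exact Fintype.card_ne_zero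

theorem content_comp_perm (x : Fin d → ℕ) (σ : Equiv.Perm (Fin d)) :
    content (x ∘ σ) = content x :=
  Equiv.sum_comp σ fun a => Finsupp.single (x a) 1

theorem exists_comp_perm_eq_of_content_eq {x y : Fin d → ℕ} (h : content x = content y) :
    ∃ σ : Equiv.Perm (Fin d), y ∘ σ = x := by
  have hcard (c : ℕ) : Fintype.card {a // x a = c} = Fintype.card {a // y a = c} := by
    rw [← content_apply, ← content_apply, h]
  exact ⟨Equiv.ofFiberEquiv fun c => Fintype.equivOfCardEq (hcard c),
    funext fun a => Equiv.ofFiberEquiv_map _ a⟩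

/-- The words of length `d` in which each letter `c` occurs `n c` times. -/
def wordsOfContent (d : ℕ) (n : ℕ →₀ ℕ) : SubMulAction (Equiv.Perm (Fin d)) (Fin d → ℕ) where
  carrier := {x | content x = n}
  smul_mem' σ _ hx := (content_comp_perm _ σ⁻¹).trans hx

instance (n : ℕ →₀ ℕ) : Fintype (wordsOfContent d n) :=
  (finite_content_eq n).fintype

instance (n : ℕ →₀ ℕ) : IsPretransitive (Equiv.Perm (Fin d)) (wordsOfContent d n) where
  exists_smul_eq x y := by
    obtain ⟨σ, hσ⟩ := exists_comp_perm_eq_of_content_eq (y.2.trans x.2.symm)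
    exact ⟨σ⁻¹, Subtype.ext hσ⟩

theorem mem_stabilizer_word {n : ℕ →₀ ℕ} {x : wordsOfContent d n} {σ : Equiv.Perm (Fin d)} :
    σ ∈ stabilizer (Equiv.Perm (Fin d)) x ↔ x.1 ∘ σ = x := by
  rw [← inv_mem_iff, mem_stabilizer_iff, Subtype.ext_iff]
  rfl

theorem coeff_cycleMonomial (K : Type*) [Field K] (σ : Equiv.Perm (Fin d)) (n : ℕ →₀ ℕ) :
    MvPowerSeries.coeff n (cycleMonomial K σ) = Nat.card (fixedBy (wordsOfContent d n) σ) := by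
  have e : {x : {x : Fin d → ℕ // x ∘ σ = x} // content x.1 = n} ≃
      fixedBy (wordsOfContent d n) σ :=
    { toFun := fun x => ⟨⟨x.1.1, x.2⟩, mem_stabilizer_word.2 x.1.2⟩
      invFun := fun x => ⟨⟨x.1.1, mem_stabilizer_word.1 x.2⟩, x.1.2⟩
      left_inv := fun _ => rfl
      right_inv := fun _ => rfl }
  rw [cycleMonomial_eq_inventory, MvPowerSeries.coeff_apply, inventory, Nat.card_congr e]

end Words

section Characteristic

variable {K : Type*} [Field K] {d : ℕ} {u v : Equiv.Perm (Fin d) → K}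

theorem ch_eq_average (u : Equiv.Perm (Fin d) → K) :
    ch u = average K fun σ => u σ • cycleMonomial K σ := by
  rw [ch, average_eq, Nat.card_perm, Nat.card_fin]

theorem ch_sub (u v : Equiv.Perm (Fin d) → K) : ch (u - v) = ch u - ch v := by
  simp [ch, sub_smul, smul_sub]

theorem IsClassFun.coeff_ch [CharZero K] (hu : IsClassFun u) {n : ℕ →₀ ℕ}
    (x : wordsOfContent d n) :
    MvPowerSeries.coeff n (ch u) =
      average K fun σ : stabilizer (Equiv.Perm (Fin d)) x => u σ := by
  have hburnside := average_card_fixedBy_smul (K := K) hu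
    (isOrbitReps_const (G := Equiv.Perm (Fin d)) x)
  rw [Fintype.sum_unique] at hburnside
  rw [ch_eq_average, map_average, ← hburnside]
  simp only [map_smul, coeff_cycleMonomial, smul_eq_mul, mul_comm]

theorem exists_ker_eq (s : Setoid (Fin d)) : ∃ x : Fin d → ℕ, Setoid.ker x = s :=
  ⟨fun a => (Quotient.mk s a).out, Setoid.ext fun a b => by
    rw [Setoid.ker_def, Fin.val_inj, Quotient.out_inj, Quotient.eq]⟩

theorem isConj_of_sameCycle_setoid_eq {α : Type*} [Finite α] {σ τ : Equiv.Perm α}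
    (h : Equiv.Perm.SameCycle.setoid σ = Equiv.Perm.SameCycle.setoid τ) : IsConj σ τ := by
  classical
  cases nonempty_fintype α
  rw [Equiv.Perm.partition_eq_of_isConj, Nat.Partition.ext_iff,
    parts_partition_eq_map_card_classFinset, parts_partition_eq_map_card_classFinset, h]

-- A word `x` whose level sets are the cycles of `τ` is fixed only by permutations whose cycles
-- refine those of `τ`; for `τ` minimal with `u τ ≠ 0` the coefficient of `ch u` at the content of
-- `x` is therefore a nonzero multiple of `u τ`.
theorem IsClassFun.eq_zero_of_ch_eq_zero [CharZero K] (hu : IsClassFun u) (h : ch u = 0) :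
    u = 0 := by
  classical
  by_contra hne
  obtain ⟨τ, hτ⟩ := (Function.support u).toFinite.exists_minimalFor Equiv.Perm.SameCycle.setoid _
    (Function.support_nonempty_iff.2 hne)
  obtain ⟨x, hx⟩ := exists_ker_eq (Equiv.Perm.SameCycle.setoid τ)
  set x' : wordsOfContent d (content x) := ⟨x, rfl⟩
  have hfix (σ : Equiv.Perm (Fin d)) : σ ∈ stabilizer _ x' ↔
      Equiv.Perm.SameCycle.setoid σ ≤ Equiv.Perm.SameCycle.setoid τ := by
    rw [mem_stabilizer_word, comp_perm_eq_iff_le_ker, hx]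
  have hconst (σ : stabilizer (Equiv.Perm (Fin d)) x') (hσ : u σ ≠ 0) : u σ = u τ := by
    have hle := (hfix σ).1 σ.2
    obtain ⟨c, hc⟩ := isConj_iff.1 (isConj_of_sameCycle_setoid_eq (hle.antisymm (hτ.2 hσ hle)))
    rw [← hc, hu]
  have hsum : ∑ σ : stabilizer (Equiv.Perm (Fin d)) x', u σ = 0 := by
    have hcoeff := hu.coeff_ch x'
    rw [h, map_zero, average_eq, eq_comm, smul_eq_zero] at hcoeff
    exact hcoeff.resolve_left (inv_ne_zero (Nat.cast_ne_zero.2 Nat.card_pos.ne'))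
  rw [← Finset.sum_filter_ne_zero, Finset.sum_eq_card_nsmul
    fun σ hσ => hconst σ (Finset.mem_filter.1 hσ).2, smul_eq_zero] at hsum
  refine hτ.1 (hsum.resolve_left (Finset.card_ne_zero_of_mem (a := ⟨τ, (hfix τ).2 le_rfl⟩) ?_))
  simpa using hτ.1

theorem isClassFun_of_mem_genChar (hu : u ∈ genChar K d) : IsClassFun u := by
  induction hu using AddSubgroup.closure_induction with
  | mem u hu =>
    obtain ⟨n, ρ, rfl⟩ := hu
    exact ρ.char_conj
  | zero => exact fun g h => rfl
  | add u v _ _ hu hv => exact fun g h => congrArg₂ (· + ·) (hu g h) (hv g h)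
  | neg u _ hu => exact fun g h => congrArg Neg.neg (hu g h)

theorem ch_injOn_genChar [CharZero K] :
    Set.InjOn ch (genChar K d : Set (Equiv.Perm (Fin d) → K)) := by
  intro u hu v hv h
  have hclass := isClassFun_of_mem_genChar ((genChar K d).sub_mem hu hv)
  exact sub_eq_zero.1 (hclass.eq_zero_of_ch_eq_zero (by rw [ch_sub, h, sub_self]))

theorem internalMul_ch [CharZero K] (hu : u ∈ genChar K d) (hv : v ∈ genChar K d) :
    internalMul d (ch u) (ch v) = ch (u * v) := by
  rw [internalMul, ch_injOn_genChar.leftInvOn_invFunOn hu, ch_injOn_genChar.leftInvOn_invFunOn hv]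

theorem character_mem_genChar {V : Type*} [AddCommGroup V] [Module K V] [FiniteDimensional K V]
    (ρ : Representation K (Equiv.Perm (Fin d)) V) : ρ.character ∈ genChar K d := by
  let e : V ≃ₗ[K] (Fin (Module.finrank K V) → K) := (Module.finBasis K V).equivFun
  exact AddSubgroup.subset_closure ⟨_, e.conjRingEquiv.toMonoidHom.comp ρ,
    funext fun g => (LinearMap.trace_conj' (ρ g) e).symm⟩

theorem one_mem_genChar : (1 : Equiv.Perm (Fin d) → K) ∈ genChar K d := by
  have hone : (Representation.trivial K (Equiv.Perm (Fin d)) K).character = 1 := by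
    funext g
    simp [Representation.character, Representation.trivial]
  exact hone ▸ character_mem_genChar _

theorem mul_mem_genChar (hu : u ∈ genChar K d) (hv : v ∈ genChar K d) : u * v ∈ genChar K d := by
  induction hu, hv using AddSubgroup.closure_induction₂ with
  | mem u v hu hv =>
    obtain ⟨n, ρ, rfl⟩ := hu
    obtain ⟨m, τ, rfl⟩ := hv
    rw [← Representation.char_tensor]
    exact character_mem_genChar _
  | zero_left => rw [zero_mul]; exact zero_mem _
  | zero_right => rw [mul_zero]; exact zero_mem _
  | add_left _ _ _ _ _ _ hu hv => rw [add_mul]; exact add_mem hu hv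
  | add_right _ _ _ _ _ _ hu hv => rw [mul_add]; exact add_mem hu hv
  | neg_left _ _ _ _ h => rw [neg_mul]; exact neg_mem h
  | neg_right _ _ _ _ h => rw [mul_neg]; exact neg_mem h

theorem prod_mem_genChar {ι : Type*} (s : Finset ι) {u : ι → Equiv.Perm (Fin d) → K}
    (hu : ∀ m ∈ s, u m ∈ genChar K d) : ∏ m ∈ s, u m ∈ genChar K d :=
  Finset.prod_induction u (· ∈ genChar K d) (fun _ _ => mul_mem_genChar) one_mem_genChar hu

theorem internalProd_ch [CharZero K] {k : ℕ} {u : Fin k → Equiv.Perm (Fin d) → K}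
    (hu : ∀ m, u m ∈ genChar K d) : internalProd d (fun m => ch (u m)) = ch (∏ m, u m) := by
  induction k with
  | zero => simp [internalProd]
  | succ k ih =>
    have hprod : ∏ m : Fin k, u m.succ ∈ genChar K d :=
      prod_mem_genChar _ fun m _ => hu m.succ
    rw [Fin.prod_univ_succ, ← internalMul_ch (hu 0) hprod, ← ih fun m => hu m.succ, internalProd,
      internalProd, List.ofFn_succ, List.foldr_cons]

theorem IsMultiplier.monomialChar_mem_genChar {X : Type*} [MulAction (Equiv.Perm (Fin d)) X]
    [Fintype X] {β : X → Equiv.Perm (Fin d) → Kˣ} (hβ : IsMultiplier β) :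
    monomialChar β ∈ genChar K d := by
  classical
  let ρ : Representation K (Equiv.Perm (Fin d)) (X → K) :=
    (Matrix.toLinAlgEquiv' (R := K) (n := X)).toRingEquiv.toMonoidHom.comp hβ.matrixHom
  have hρ : ρ.character = monomialChar β :=
    funext fun g => (Matrix.trace_toLin'_eq _).trans (hβ.trace_matrixHom g)
  exact hρ ▸ character_mem_genChar ρ

end Characteristic

section Transversal

variable {G : Type*} [Group G] {W : Subgroup G} {S : Set G}

/-- A left transversal of `W` in `G`, as a `G`-set: it is identified with `G ⧸ W`. -/
def Transversal (_ : Subgroup.IsComplement S (W : Set G)) : Type _ := S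

variable {hS : Subgroup.IsComplement S (W : Set G)}

instance [Finite G] : Fintype (Transversal hS) :=
  Fintype.ofFinite S

instance : SMul G (Transversal hS) where
  smul g i := (hS.equiv (g * i.1)).1

theorem equiv_mul_coe (hS : Subgroup.IsComplement S (W : Set G)) (i : S) (w : W) :
    hS.equiv (i.1 * w) = (i, w) :=
  hS.equiv.apply_symm_apply (i, w)

theorem equiv_mul_mul (g h : G) (i : Transversal hS) : hS.equiv (g * h * i.1) =
    (g • h • i, (hS.equiv (g * (h • i).1)).2 * (hS.equiv (h * i.1)).2) := by
  conv_lhs => rw [mul_assoc, ← hS.equiv_fst_mul_equiv_snd (h * i.1), ← mul_assoc]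
  exact hS.equiv_mul_right _ _

theorem smul_eq_of_mul_eq {g : G} {i j : Transversal hS} {w : W} (h : g * i.1 = j.1 * w) :
    g • i = j :=
  congrArg Prod.fst ((congrArg hS.equiv h).trans (equiv_mul_coe hS j w))

instance : MulAction G (Transversal hS) where
  one_smul i := smul_eq_of_mul_eq (w := 1) (by simp)
  mul_smul g h i := (congrArg Prod.fst (equiv_mul_mul g h i) :)

instance : IsPretransitive G (Transversal hS) where
  exists_smul_eq i j := ⟨j.1 * i.1⁻¹, smul_eq_of_mul_eq (w := 1) (by simp)⟩

theorem stabilizer_transversal (i : Transversal hS) :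
    stabilizer G i = W.map (MulAut.conj i.1).toMonoidHom := by
  ext g
  constructor
  · intro (hg : (hS.equiv (g * i.1)).1 = i)
    refine ⟨_, (hS.equiv (g * i.1)).2.2, mul_inv_eq_of_eq_mul ?_⟩
    conv_rhs => rw [← hS.equiv_fst_mul_equiv_snd (g * i.1), hg]
  · rintro ⟨w, hw, rfl⟩
    exact smul_eq_of_mul_eq (w := ⟨w, hw⟩) (inv_mul_cancel_right _ _)

theorem exists_transversal_mem (hS : Subgroup.IsComplement S (W : Set G)) :
    ∃ i : Transversal hS, i.1 ∈ W := by
  obtain ⟨⟨i, w⟩, h⟩ := hS.equiv.symm.surjective 1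
  exact ⟨i, eq_inv_of_mul_eq_one_left h ▸ inv_mem w.2⟩

section Induced

variable {R : Type*} [CommRing R] {χ : W →* Rˣ}

/-- The multiplier of the monomial representation induced from the character `χ` of `W`. -/
def inducedMultiplier (hS : Subgroup.IsComplement S (W : Set G)) (χ : W →* Rˣ)
    (i : Transversal hS) (g : G) : Rˣ :=
  χ (hS.equiv (g * i.1)).2

/-- The character of `G` induced from the character `χ` of `W`. -/
def inducedChar [Finite G] (hS : Subgroup.IsComplement S (W : Set G)) (χ : W →* Rˣ) : G → R :=
  monomialChar (inducedMultiplier hS χ)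

theorem isMultiplier_inducedMultiplier : IsMultiplier (inducedMultiplier hS χ) := by
  intro i g h
  rw [inducedMultiplier, equiv_mul_mul, map_mul, inducedMultiplier, inducedMultiplier]

theorem inducedMultiplier_of_mem {i : Transversal hS} (hi : i.1 ∈ W) (w : W) :
    inducedMultiplier hS χ i w = χ w := by
  have hconj : (w : G) * i.1 = i.1 * ((⟨i.1, hi⟩⁻¹ * w * ⟨i.1, hi⟩ : W) : G) := by
    simp [mul_assoc]
  rw [inducedMultiplier, hconj, equiv_mul_coe hS i, map_mul, map_mul, map_inv,
    inv_mul_cancel_comm]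

end Induced

end Transversal

section CycleIndex

variable {K : Type*} [Field K] {d : ℕ}

theorem cycleIndex_eq_average {W : Subgroup (Equiv.Perm (Fin d))} (χ : W →* Kˣ) :
    cycleIndex χ = average K fun σ : W => (χ σ : K) • cycleMonomial K (σ : Equiv.Perm (Fin d)) := by
  classical
  rw [cycleIndex, average_eq]

theorem cycleIndex_congr {H H' : Subgroup (Equiv.Perm (Fin d))} (h : H = H') {χ : H →* Kˣ}
    {χ' : H' →* Kˣ} (hχ : ∀ (σ : H) (τ : H'), σ.1 = τ.1 → χ σ = χ' τ) :
    cycleIndex χ = cycleIndex χ' := by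
  subst h
  exact congrArg cycleIndex (MonoidHom.ext fun σ => hχ σ σ rfl)

theorem ch_monomialChar [CharZero K] {X T : Type*} [MulAction (Equiv.Perm (Fin d)) X] [Fintype X]
    [Fintype T] {β : X → Equiv.Perm (Fin d) → Kˣ} (hβ : IsMultiplier β) {r : T → X}
    (hr : IsOrbitReps (Equiv.Perm (Fin d)) r) :
    ch (monomialChar β) = ∑ t, cycleIndex (hβ.stabilizerHom (r t)) := by
  simp_rw [ch_eq_average, average_monomialChar_smul hβ (isClassFun_cycleMonomial K) hr,
    cycleIndex_eq_average]
  rfl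

theorem ch_inducedChar [CharZero K] {W : Subgroup (Equiv.Perm (Fin d))}
    {S : Set (Equiv.Perm (Fin d))}
    (hS : Subgroup.IsComplement S (W : Set (Equiv.Perm (Fin d)))) (χ : W →* Kˣ) :
    ch (inducedChar hS χ) = cycleIndex χ := by
  obtain ⟨i, hi⟩ := exists_transversal_mem hS
  rw [inducedChar, ch_monomialChar isMultiplier_inducedMultiplier (isOrbitReps_const i),
    Fintype.sum_unique]
  have hstab : stabilizer (Equiv.Perm (Fin d)) i = W :=
    (stabilizer_transversal i).trans
      (Subgroup.mem_normalizer_iff_map_conj_eq.1 (Subgroup.le_normalizer hi))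
  refine cycleIndex_congr hstab ?_
  rintro ⟨_, -⟩ w rfl
  exact inducedMultiplier_of_mem hi w

theorem ch_prod_inducedChar [CharZero K] {k : ℕ} {W : Fin k → Subgroup (Equiv.Perm (Fin d))}
    {I : Fin k → Set (Equiv.Perm (Fin d))}
    (hI : ∀ m, Subgroup.IsComplement (I m) (W m : Set (Equiv.Perm (Fin d))))
    (χ : ∀ m, W m →* Kˣ) {T : Set (∀ m, I m)} [Fintype T] (hT : IsRepSystem hI T) :
    ch (∏ m, inducedChar (hI m) (χ m)) = ∑ ω : T, cycleIndex (psi hI χ ω.1) := by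
  let r (ω : T) : ∀ m, Transversal (hI m) := ω.1
  have hr : IsOrbitReps (Equiv.Perm (Fin d)) r := by
    intro i
    obtain ⟨ω, ⟨hω, hωi⟩, hunique⟩ := hT i
    exact ⟨⟨ω, hω⟩, hωi, fun τ hτ => Subtype.ext (hunique τ ⟨τ.2, hτ⟩)⟩
  have hprod : ∏ m, inducedChar (hI m) (χ m) =
      monomialChar fun (i : ∀ m, Transversal (hI m)) ζ =>
        ∏ m, inducedMultiplier (hI m) (χ m) (i m) ζ := by
    ext ζ
    exact (Finset.prod_apply ζ _ _).trans
      (monomialChar_pi (fun m => inducedMultiplier _ (χ m)) ζ).symm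
  have hstab (i : ∀ m, Transversal (hI m)) : stabilizer (Equiv.Perm (Fin d)) i = stab W i := by
    ext ζ
    simp only [mem_stabilizer_iff, funext_iff, Pi.smul_apply, stab, Subgroup.mem_iInf,
      ← stabilizer_transversal]
  rw [hprod, ch_monomialChar (isMultiplier_pi fun m => isMultiplier_inducedMultiplier) hr]
  refine Finset.sum_congr rfl fun ω _ => cycleIndex_congr (hstab ω.1) ?_
  rintro ⟨_, -⟩ ζ rfl
  rfl

end CycleIndex

section NormalSubgroup

open Pointwise

variable {H X : Type*} [Group H] [MulAction H X] (N : Subgroup H) [N.Normal] (x : X)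

theorem setOf_orbit_subset_orbit :
    {P | P ⊆ orbit H x ∧ ∃ y, P = orbit N y} = orbit H (orbit N x) := by
  ext P
  constructor
  · rintro ⟨hP, y, rfl⟩
    obtain ⟨h, rfl⟩ := hP (mem_orbit_self y)
    exact ⟨h, smul_orbit_eq_orbit_smul N x h⟩
  · rintro ⟨h, rfl⟩
    refine ⟨?_, h • x, smul_orbit_eq_orbit_smul N x h⟩
    rintro _ ⟨_, ⟨g, rfl⟩, rfl⟩
    exact ⟨h * g, mul_smul _ _ _⟩

theorem stabilizer_orbit_of_normal : stabilizer H (orbit N x) = N ⊔ stabilizer H x := by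
  ext h
  rw [mem_stabilizer_iff, smul_orbit_eq_orbit_smul, orbit_eq_iff, Subgroup.mem_sup_of_normal_left]
  constructor
  · rintro ⟨n, hn : n.1 • x = h • x⟩
    refine ⟨n, n.2, n.1⁻¹ * h, ?_, mul_inv_cancel_left _ _⟩
    rw [mem_stabilizer_iff, mul_smul, ← hn, inv_smul_smul]
  · rintro ⟨n, hn, g, hg, rfl⟩
    exact ⟨⟨n, hn⟩, by rw [mul_smul, hg]; rfl⟩

theorem ncard_orbits_eq_index_iff [N.FiniteIndex] :
    {P | P ⊆ orbit H x ∧ ∃ y, P = orbit N y}.ncard = N.index ↔ stabilizer H x ≤ N := by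
  rw [setOf_orbit_subset_orbit, ← index_stabilizer, stabilizer_orbit_of_normal, ← sup_eq_left]
  refine ⟨fun h => ?_, congrArg Subgroup.index⟩
  by_contra hne
  exact (Subgroup.index_strictAnti (lt_of_le_of_ne' le_sup_left hne)).ne h

end NormalSubgroup

open Classical in
theorem average_hom_subgroup {K G : Type*} [Field K] [CharZero K] [Group G] [Finite G]
    (ψ : G →* Kˣ) (S : Subgroup G) :
    average K (fun g : S => (ψ g : K)) = if S ≤ ψ.ker then 1 else 0 := by
  cases nonempty_fintype G
  let f : S →* K := (Units.coeHom K).comp (ψ.comp S.subtype)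
  have hf : f = 1 ↔ S ≤ ψ.ker := by
    simp [f, MonoidHom.ext_iff, SetLike.le_def]
  have hsum : ∑ g : S, (ψ g : K) = _ := sum_hom_units f
  have hne : (Nat.card S : K) ≠ 0 := Nat.cast_ne_zero.2 Nat.card_pos.ne'
  rw [average_eq, smul_eq_mul, inv_mul_eq_iff_eq_mul₀ hne, mul_ite, mul_one, mul_zero]
  simpa [hf] using hsum

section MaxOrbits

variable {d : ℕ} {H : Subgroup (Equiv.Perm (Fin d))}

theorem orbitWeight_wordOrbit (H : Subgroup (Equiv.Perm (Fin d))) (x : Fin d → ℕ) :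
    orbitWeight (wordOrbit H x) = content x := by
  have hne : (wordOrbit H x).Nonempty := ⟨_, 1, rfl⟩
  rw [orbitWeight, dif_pos hne]
  obtain ⟨σ, hσ⟩ := hne.some_mem
  rw [← hσ]
  exact content_comp_perm x _

theorem wordOrbit_map_subtype (N : Subgroup H) (x : Fin d → ℕ) :
    wordOrbit (N.map H.subtype) x = orbit N x := by
  ext y
  constructor
  · rintro ⟨⟨_, σ, hσ, rfl⟩, rfl⟩
    exact ⟨⟨σ, hσ⟩, rfl⟩
  · rintro ⟨⟨σ, hσ⟩, rfl⟩
    exact ⟨⟨_, σ, hσ, rfl⟩, rfl⟩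

theorem wordOrbit_mem_maxOrbits_iff {K : Type*} [Field K] (ψ : H →* Kˣ) (x : Fin d → ℕ) :
    wordOrbit H x ∈ maxOrbits ψ ↔ stabilizer H x ≤ ψ.ker := by
  rw [← ncard_orbits_eq_index_iff ψ.ker x, maxOrbits]
  simp only [wordOrbit_map_subtype, Set.mem_ofPred_eq]
  exact and_iff_right ⟨x, rfl⟩

/-- The set of the `H`-orbits in `ℕ^d` whose weight is the monomial with exponent `n`. -/
def orbitsOfWeight (H : Subgroup (Equiv.Perm (Fin d))) (n : ℕ →₀ ℕ) : Set (Set (Fin d → ℕ)) :=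
  {O | (∃ x, O = wordOrbit H x) ∧ orbitWeight O = n}

theorem finite_orbitsOfWeight (n : ℕ →₀ ℕ) : (orbitsOfWeight H n).Finite := by
  refine ((finite_content_eq n).image (wordOrbit H)).subset ?_
  rintro _ ⟨⟨x, rfl⟩, hn⟩
  exact ⟨x, (orbitWeight_wordOrbit H x).symm.trans hn, rfl⟩

theorem exists_wordsOfContent_eq_wordOrbit {n : ℕ →₀ ℕ} (O : orbitsOfWeight H n) :
    ∃ x : wordsOfContent d n, O.1 = wordOrbit H x := by
  obtain ⟨_, ⟨x, rfl⟩, hn⟩ := O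
  exact ⟨⟨x, (orbitWeight_wordOrbit H x).symm.trans hn⟩, rfl⟩

theorem isOrbitReps_orbitsOfWeight {n : ℕ →₀ ℕ} {r : orbitsOfWeight H n → wordsOfContent d n}
    (hr : ∀ O, O.1 = wordOrbit H (r O)) : IsOrbitReps H r := by
  intro x
  have hmem (O : orbitsOfWeight H n) : x ∈ orbit H (r O) ↔ O.1 = wordOrbit H x.1 := by
    rw [hr]
    refine Iff.trans ?_ (orbit_eq_iff.symm.trans eq_comm)
    exact ⟨fun ⟨σ, hσ⟩ => ⟨σ, congrArg Subtype.val hσ⟩, fun ⟨σ, hσ⟩ => ⟨σ, Subtype.ext hσ⟩⟩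
  refine ⟨⟨wordOrbit H x.1, ⟨x, rfl⟩, (orbitWeight_wordOrbit H x).trans x.2⟩,
    (hmem _).2 rfl, fun O hO => Subtype.ext ((hmem O).1 hO)⟩

variable {K : Type*} [Field K]

theorem finite_maxOrbits_orbitWeight_eq (ψ : H →* Kˣ) (n : ℕ →₀ ℕ) :
    {O : maxOrbits ψ | orbitWeight O.1 = n}.Finite :=
  ((finite_orbitsOfWeight n).preimage Subtype.val_injective.injOn).subset
    fun O hO => ⟨O.2.1, hO⟩

open Classical in
theorem coeff_cycleIndex [CharZero K] (ψ : H →* Kˣ) (n : ℕ →₀ ℕ) [Fintype (orbitsOfWeight H n)] :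
    MvPowerSeries.coeff n (cycleIndex ψ) =
      ∑ O : orbitsOfWeight H n, if O.1 ∈ maxOrbits ψ then 1 else 0 := by
  choose r hr using exists_wordsOfContent_eq_wordOrbit (H := H) (n := n)
  have hclass : IsClassFun fun σ : H => (ψ σ : K) := fun σ τ => by simp
  have hmax (O : orbitsOfWeight H n) : O.1 ∈ maxOrbits ψ ↔ stabilizer H (r O) ≤ ψ.ker := by
    have hstab : stabilizer H (r O) = stabilizer H (r O).1 :=
      Subgroup.ext fun _ => Subtype.ext_iff
    rw [hr O, wordOrbit_mem_maxOrbits_iff, hstab]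
  have hburnside := average_card_fixedBy_smul (K := K) hclass (isOrbitReps_orbitsOfWeight hr)
  simp only [average_hom_subgroup, ← hmax] at hburnside
  rw [← hburnside, cycleIndex_eq_average, map_average]
  simp only [map_smul, coeff_cycleMonomial, smul_eq_mul, mul_comm]
  rfl

theorem cycleIndex_eq_inventory [CharZero K] (ψ : H →* Kˣ) :
    cycleIndex ψ = inventory K fun O : maxOrbits ψ => orbitWeight O.1 := by
  classical
  ext n
  have := (finite_orbitsOfWeight (H := H) n).fintype
  rw [coeff_cycleIndex, Finset.sum_boole, ← Fintype.card_subtype, ← Nat.card_eq_fintype_card,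
    MvPowerSeries.coeff_apply, inventory]
  exact congrArg Nat.cast (Nat.card_congr
    { toFun := fun O => ⟨⟨O.1.1, O.2⟩, O.1.2.2⟩
      invFun := fun O => ⟨⟨O.1.1, O.1.2.1, O.2⟩, O.1.2⟩
      left_inv := fun _ => rfl
      right_inv := fun _ => rfl })

end MaxOrbits

end

end Redfield

open Redfield in
theorem theorem4p1p2_general {K : Type*} [Field K] [CharZero K] (d k : ℕ)
    (W : Fin k → Subgroup (Equiv.Perm (Fin d))) (χ : ∀ m, W m →* Kˣ)
    (I : Fin k → Set (Equiv.Perm (Fin d)))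
    (hI : ∀ m, Subgroup.IsComplement (I m) (W m : Set (Equiv.Perm (Fin d))))
    (T : Set (∀ m, I m)) (hT : Redfield.IsRepSystem hI T) :
    (∀ n : ℕ →₀ ℕ, {u : Redfield.U hI χ T | u.weight = n}.Finite) ∧
      Redfield.internalProd d (fun m => Redfield.cycleIndex (χ m)) =
        Redfield.inventory K (fun u : Redfield.U hI χ T => u.weight) := by
  have := Fintype.ofFinite T
  have hfinite (n : ℕ →₀ ℕ) (ω : T) := finite_maxOrbits_orbitWeight_eq (psi hI χ ω) n
  refine ⟨fun n => finite_sigma_weight_eq (hfinite n), ?_⟩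
  calc internalProd d (fun m => cycleIndex (χ m))
      = ch (∏ m, inducedChar (hI m) (χ m)) := by
        simp_rw [← ch_inducedChar (hI _)]
        exact internalProd_ch fun m => isMultiplier_inducedMultiplier.monomialChar_mem_genChar
    _ = ∑ ω : T, cycleIndex (psi hI χ ω) := ch_prod_inducedChar hI χ hT
    _ = ∑ ω : T, inventory K fun O : maxOrbits (psi hI χ ω) => orbitWeight O.1 := by
        simp_rw [cycleIndex_eq_inventory]
    _ = inventory K fun u : U hI χ T => u.weight :=
        (inventory_sigma K fun ω n => hfinite n ω).symm

theorem theorem4p1p2 {K : Type*} [Field K] [IsAlgClosed K] [CharZero K] (d k : ℕ)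
    (W : Fin k → Subgroup (Equiv.Perm (Fin d))) (χ : ∀ m, W m →* Kˣ)
    (I : Fin k → Set (Equiv.Perm (Fin d)))
    (hI : ∀ m, Subgroup.IsComplement (I m) (W m : Set (Equiv.Perm (Fin d))))
    (T : Set (∀ m, I m)) (hT : Redfield.IsRepSystem hI T) :
    (∀ n : ℕ →₀ ℕ, {u : Redfield.U hI χ T | u.weight = n}.Finite) ∧
      Redfield.internalProd d (fun m => Redfield.cycleIndex (χ m)) =
        Redfield.inventory K (fun u : Redfield.U hI χ T => u.weight) :=
  theorem4p1p2_general d k W χ I hI T hT
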